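/- Let $p$ be an odd prime, $s\ge 1$, $q=p^s$, let $\mathbb F_q$ be the field with $q$ elements, $\chi$ its quadratic character, and $H=\{x^2 : x\in\mathbb F_q^*\}$. For an integer $k\ge 0$ let $N_H(k,0)$ be the number of $k$-element subsets $S\subseteq H$ with $\sum_{a\in S}a=0$. For complex numbers $t_1,\dots,t_k$ put $$C_k(t_1,\dots,t_k)=\sum_{\substack{c_1,\dots,c_k\ge 0\\ \sum_i i c_i=k}}\frac{k!}{1^{c_1}c_1!\,2^{c_2}c_2!\cdots k^{c_k}c_k!}\;t_1^{c_1}\cdots t_k^{c_k},$$ and for $b\in\mathbb F_q^*$ and complex numbers $u,v,w$ let $A_{k,b}(u,v,w)=C_k(t_1,\dots,t_k)$, where $t_i=w$ if $p\mid i$, $t_i=u$ if $p\nmid i$ and $\chi(i)=\chi(b)$, and $t_i=v$ if $p\nmid i$ and $\chi(i)=-\chi(b)$. (1) If $p\equiv 1 \pmod 4$, or $p\equiv 3\pmod 4$ and $s$ is even, then $$N_H(k,0)=\frac1q\binom{\frac{q-1}{2}}{k}+(-1)^k\frac{q-1}{2q\,k!}\Big\{A_{k,1}\Big(\tfrac{1-\sqrt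 q}{2},\tfrac{1+\sqrt q}{2},\tfrac{1-q}{2}\Big)+A_{k,1}\Big(\tfrac{1+\sqrt q}{2},\tfrac{1-\sqrt q}{2},\tfrac{1-q}{2}\Big)\Big\}.$$ (2) If $p\equiv 3\pmod 4$ and $s$ is odd, then, with $\mathrm i=\sqrt{-1}\in\mathbb C$, $$N_H(k,0)=\frac1q\binom{\frac{q-1}{2}}{k}+(-1)^k\frac{q-1}{2q\,k!}\Big\{A_{k,1}\Big(\tfrac{1-\sqrt q\,\mathrm i}{2},\tfrac{1+\sqrt q\,\mathrm i}{2},\tfrac{1-q}{2}\Big)+A_{k,1}\Big(\tfrac{1+\sqrt q\,\mathrm i}{2},\tfrac{1-\sqrt q\,\mathrm i}{2},\tfrac{1-q}{2}\Big)\Big\}.$$ -/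

import Mathlib

open scoped Nat

noncomputable section

/-- `N_H(k, b)`: the number of `k`-element subsets `S ⊆ H` with `∑_{a ∈ S} a = b`. -/
def subsetSumCount {F : Type*} [AddCommMonoid F] [DecidableEq F]
    (H : Finset F) (k : ℕ) (b : F) : ℕ :=
  ((H.powersetCard k).filter (fun S => ∑ a ∈ S, a = b)).card

/-- The set `{x ^ 2 | x ∈ F, x ≠ 0}` of (nonzero) quadratic residues of a finite field. -/
def quadraticResidues (F : Type*) [Field F] [Fintype F] [DecidableEq F] : Finset F :=
  (Finset.univ.filter (fun x : F => x ≠ 0)).image (fun x => x ^ 2)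

/-- The number `k! / (1 ^ c₁ c₁! 2 ^ c₂ c₂! ⋯ k ^ cₖ cₖ!)` of permutations of `k` letters with
exactly `cᵢ` cycles of length `i`. A type `(c₁, …, cₖ)` with `∑ i cᵢ = k` is given as the partition
of `k` in which the part `i` occurs `cᵢ` times. -/
def permTypeCount {k : ℕ} (c : Nat.Partition k) : ℂ :=
  (k ! : ℂ) / ∏ i ∈ Finset.Icc 1 k, ((i : ℂ) ^ c.parts.count i * ((c.parts.count i)! : ℂ))

/-- `C_k(t₁, …, tₖ) = ∑_{∑ i cᵢ = k} N(c₁, …, cₖ) t₁ ^ c₁ ⋯ tₖ ^ cₖ`. -/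
def cycleSum (k : ℕ) (t : ℕ → ℂ) : ℂ :=
  ∑ c : Nat.Partition k, permTypeCount c * ∏ i ∈ Finset.Icc 1 k, t i ^ c.parts.count i

/-- `A_{k,b}(u, v, w) = C_k(t₁, …, tₖ)` for a unit `b` of a finite field of characteristic `p`,
where `tᵢ = w` if `p ∣ i`, and otherwise `tᵢ = u` if `χ(i) = χ(b)` and `tᵢ = v` if
`χ(i) = -χ(b)`, with `χ` the quadratic character of the field. -/
def twistedCycleSum {F : Type*} [Field F] [Fintype F] [DecidableEq F] (p k : ℕ) (b : Fˣ)
    (u v w : ℂ) : ℂ :=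
  cycleSum k (fun i =>
    if p ∣ i then w
    else if quadraticChar F (i : F) = quadraticChar F (b : F) then u
    else v)

end

/-! Orthogonality of the characters `h ↦ ψ (x * h)` writes `q * N_H(k,0)` as the sum over `x` of the
`k`-th elementary symmetric function of the values `ψ (x * h)`, `h ∈ H` (`card_mul_subsetSumCount`).
The term `x = 0` is the binomial coefficient. For `x ≠ 0`, the `i`-th power sum is `∑ ψ (i * x *
h)`: it equals `|H|` if `p ∣ i`, and `(χ(i) χ(x) G - 1) / 2` otherwise, with `G` the quadratic Gauss
sum. Newton's identities, solved by `esymmSum_eq_partitionSum`, make the term a cycle sum in the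
negated power sums. It depends only on `χ(x)`, and each sign occurs `(q - 1) / 2` times. The total
is even in `G`, so `G ^ 2 = χ(-1) q` suffices and the sign of the Gauss sum is not needed. -/

/-- The sum over the `k`-subsets of a finite set of the products of the values of `g`. -/
noncomputable def esymmSum {ι R : Type*} [CommRing R] (s : Finset ι) (g : ι → R) (k : ℕ) : R :=
  ∑ S ∈ s.powersetCard k, ∏ a ∈ S, g a

theorem aeval_esymm_subtype {ι R : Type*} [CommRing R] (s : Finset ι) (g : ι → R) (k : ℕ) :
    MvPolynomial.aeval (fun x : s => g x) (MvPolynomial.esymm s R k) = esymmSum s g k := by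
  rw [MvPolynomial.aeval_esymm_eq_multiset_esymm, esymmSum, ← Finset.esymm_map_val]
  congr 1
  exact Multiset.attach_map_val' s.val g

theorem newton_esymmSum {ι R : Type*} [CommRing R] (s : Finset ι) (g : ι → R) (k : ℕ) :
    (k : R) * esymmSum s g k = (-1) ^ (k + 1) *
      ∑ a ∈ Finset.HasAntidiagonal.antidiagonal k with a.1 < k,
        (-1) ^ a.1 * esymmSum s g a.1 * ∑ i ∈ s, g i ^ a.2 := by
  have h := congrArg (MvPolynomial.aeval (fun x : s => g x))
    (MvPolynomial.mul_esymm_eq_sum s R k)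
  have hsum : ∀ n, ∑ x : s, g x ^ n = ∑ i ∈ s, g i ^ n := fun n =>
    Finset.sum_coe_sort s (fun i => g i ^ n)
  simpa only [map_mul, map_sum, map_pow, map_neg, map_one, map_natCast, aeval_esymm_subtype,
    MvPolynomial.psum, MvPolynomial.aeval_X, hsum] using h

/-! ### Cycle sums over partitions -/

/-- The multisets of positive integers with sum `k`. -/
def partitionMultisets (k : ℕ) : Finset (Multiset ℕ) :=
  Finset.univ.image (fun c : Nat.Partition k => c.parts)

theorem mem_partitionMultisets {k : ℕ} {m : Multiset ℕ} :
    m ∈ partitionMultisets k ↔ (∀ i ∈ m, 0 < i) ∧ m.sum = k := by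
  simp only [partitionMultisets, Finset.mem_image, Finset.mem_univ, true_and]
  constructor
  · rintro ⟨c, rfl⟩
    exact ⟨fun i hi => c.parts_pos hi, c.parts_sum⟩
  · rintro ⟨h, h'⟩
    exact ⟨⟨m, fun hi => h _ hi, h'⟩, rfl⟩

/-- The weight `∏ (tᵢ / i) ^ cᵢ / cᵢ!` of a multiset with multiplicities `cᵢ`. -/
noncomputable def cycleWeight (t : ℕ → ℂ) (m : Multiset ℕ) : ℂ :=
  ∏ i ∈ m.toFinset, (t i / i) ^ m.count i / ((m.count i)! : ℂ)

theorem cycleWeight_eq_prod (t : ℕ → ℂ) (m : Multiset ℕ) (s : Finset ℕ) (h : m.toFinset ⊆ s) :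
    cycleWeight t m = ∏ i ∈ s, (t i / i) ^ m.count i / ((m.count i)! : ℂ) := by
  refine Finset.prod_subset h fun i _ hi => ?_
  have : m.count i = 0 := by simpa using hi
  simp [this]

theorem cycleWeight_cons (t : ℕ → ℂ) (m : Multiset ℕ) {i : ℕ} (hi : i ≠ 0) :
    (i : ℂ) * ((i ::ₘ m).count i : ℂ) * cycleWeight t (i ::ₘ m) = cycleWeight t m * t i := by
  have hi' : (i : ℂ) ≠ 0 := by exact_mod_cast hi
  have hs : m.toFinset ⊆ (i ::ₘ m).toFinset := by simp
  have hmem : i ∈ (i ::ₘ m).toFinset := by simp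
  rw [cycleWeight_eq_prod t m _ hs, cycleWeight, ← Finset.mul_prod_erase _ _ hmem,
    ← Finset.mul_prod_erase _ (fun j => (t j / j) ^ m.count j / ((m.count j)! : ℂ)) hmem]
  have : ∀ j ∈ (i ::ₘ m).toFinset.erase i,
      (t j / j) ^ (i ::ₘ m).count j / (((i ::ₘ m).count j)! : ℂ) =
        (t j / j) ^ m.count j / ((m.count j)! : ℂ) := by
    intro j hj
    rw [Multiset.count_cons_of_ne (Finset.ne_of_mem_erase hj)]
  rw [Finset.prod_congr rfl this, Multiset.count_cons_self, Nat.factorial_succ, pow_succ]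
  have h1 : ((m.count i : ℂ) + 1) ≠ 0 := by exact_mod_cast (m.count i).succ_ne_zero
  have h2 : ((m.count i)! : ℂ) ≠ 0 := by exact_mod_cast Nat.factorial_ne_zero _
  push_cast
  field_simp

/-- The total weight of the partitions of `k`, which is `C_k / k!`. -/
noncomputable def partitionSum (t : ℕ → ℂ) (k : ℕ) : ℂ :=
  ∑ m ∈ partitionMultisets k, cycleWeight t m

theorem cycleSum_eq_factorial_mul (k : ℕ) (t : ℕ → ℂ) :
    cycleSum k t = (k ! : ℂ) * partitionSum t k := by
  rw [cycleSum, partitionSum, partitionMultisets, Finset.sum_image, Finset.mul_sum]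
  · refine Finset.sum_congr rfl fun c _ => ?_
    rw [cycleWeight_eq_prod t c.parts (Finset.Icc 1 k), permTypeCount, div_mul_eq_mul_div,
      mul_div_assoc, ← Finset.prod_div_distrib]
    · congr 1
      refine Finset.prod_congr rfl fun i _ => ?_
      rw [div_pow, div_div]
    · intro i hi
      have hi := Multiset.mem_toFinset.1 hi
      exact Finset.mem_Icc.2 ⟨c.parts_pos hi, c.parts_sum ▸ Multiset.le_sum_of_mem hi⟩
  · intro c _ d _ h
    exact Nat.Partition.ext h

/-- Writing `k = ∑ i cᵢ` inside each term marks a part size `i`; removing one such part leaves a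
partition of `k - i`. Up to signs this is Newton's recursion. -/
theorem partitionSum_rec (t : ℕ → ℂ) (k : ℕ) :
    (k : ℂ) * partitionSum t k =
      ∑ a ∈ Finset.HasAntidiagonal.antidiagonal k with a.1 < k, partitionSum t a.1 * t a.2 := by
  have h : (k : ℂ) * partitionSum t k =
      ∑ m ∈ partitionMultisets k, ∑ i ∈ m.toFinset,
        (i : ℂ) * (m.count i : ℂ) * cycleWeight t m := by
    rw [partitionSum, Finset.mul_sum]
    refine Finset.sum_congr rfl fun m hm => ?_
    rw [← Finset.sum_mul, ← (mem_partitionMultisets.1 hm).2, Finset.sum_multiset_count]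
    congr 1
    push_cast
    exact Finset.sum_congr rfl fun i _ => by rw [smul_eq_mul, Nat.cast_mul, mul_comm]
  rw [h]
  simp only [partitionSum, Finset.sum_mul]
  rw [Finset.sum_sigma', Finset.sum_sigma']
  refine Finset.sum_bij' (fun x _ => ⟨(k - x.2, x.2), x.1.erase x.2⟩)
    (fun y _ => ⟨y.1.2 ::ₘ y.2, y.1.2⟩) ?_ ?_ ?_ ?_ ?_
  · rintro ⟨m, i⟩ hx
    simp only [Finset.mem_sigma, mem_partitionMultisets, Multiset.mem_toFinset,
      Finset.mem_filter, Finset.HasAntidiagonal.mem_antidiagonal] at hx ⊢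
    obtain ⟨⟨hpos, hsum⟩, hi⟩ := hx
    have := Multiset.sum_erase hi
    have := hpos i hi
    exact ⟨⟨by omega, by omega⟩, fun j hj => hpos j (Multiset.mem_of_mem_erase hj), by omega⟩
  · rintro ⟨⟨a, i⟩, m⟩ hy
    simp only [Finset.mem_sigma, mem_partitionMultisets, Multiset.mem_toFinset,
      Finset.mem_filter, Finset.HasAntidiagonal.mem_antidiagonal, Multiset.mem_cons, Multiset.sum_cons] at hy ⊢
    obtain ⟨⟨h1, h2⟩, hpos, hsum⟩ := hy
    refine ⟨⟨?_, by omega⟩, Or.inl trivial⟩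
    rintro j (rfl | hj)
    · omega
    · exact hpos j hj
  · rintro ⟨m, i⟩ hx
    simp only [Finset.mem_sigma, Multiset.mem_toFinset] at hx
    simp [Multiset.cons_erase hx.2]
  · rintro ⟨⟨a, i⟩, m⟩ hy
    simp only [Finset.mem_sigma, Finset.mem_filter, Finset.HasAntidiagonal.mem_antidiagonal] at hy
    have : k - i = a := by omega
    simp [this]
  · rintro ⟨m, i⟩ hx
    simp only [Finset.mem_sigma, mem_partitionMultisets, Multiset.mem_toFinset] at hx
    have := cycleWeight_cons t (m.erase i) (hx.1.1 i hx.2).ne'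
    rwa [Multiset.cons_erase hx.2] at this

theorem partitionSum_zero (t : ℕ → ℂ) : partitionSum t 0 = 1 := by
  simp [partitionSum, partitionMultisets, cycleWeight]

/-- The expression of an elementary symmetric sum by power sums. -/
theorem esymmSum_eq_partitionSum {ι : Type*} (s : Finset ι) (g : ι → ℂ) (t : ℕ → ℂ)
    (ht : ∀ i, 0 < i → t i = -∑ a ∈ s, g a ^ i) (k : ℕ) :
    esymmSum s g k = (-1) ^ k * partitionSum t k := by
  induction k using Nat.strong_induction_on with
  | _ k ih =>
    rcases Nat.eq_zero_or_pos k with rfl | hk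
    · simp [esymmSum, partitionSum_zero]
    · have hk' : (k : ℂ) ≠ 0 := by exact_mod_cast hk.ne'
      apply mul_left_cancel₀ hk'
      -- The two recursions now match term by term: the extra `-1` is absorbed by `t = -(power
      -- sum)`.
      rw [newton_esymmSum, mul_left_comm, partitionSum_rec, pow_succ, mul_assoc, neg_one_mul,
        ← Finset.sum_neg_distrib]
      congr 1
      refine Finset.sum_congr rfl fun a ha => ?_
      simp only [Finset.mem_filter, Finset.HasAntidiagonal.mem_antidiagonal] at ha
      rw [ih a.1 ha.2, ht a.2 (by omega), ← mul_assoc, ← mul_pow]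
      simp

/-! ### Character sums over the quadratic residues -/

section FiniteField

variable {F : Type*} [Field F] [Fintype F] [DecidableEq F]

/-- The quadratic character of a finite field with complex values. -/
noncomputable def complexQuadraticChar (F : Type*) [Field F] [Fintype F] [DecidableEq F] :
    MulChar F ℂ :=
  (quadraticChar F).ringHomComp (Int.castRingHom ℂ)

theorem complexQuadraticChar_apply (x : F) :
    complexQuadraticChar F x = ((quadraticChar F x : ℤ) : ℂ) := rfl

theorem mem_quadraticResidues {x : F} : x ∈ quadraticResidues F ↔ x ≠ 0 ∧ IsSquare x := by
  simp only [quadraticResidues, Finset.mem_image, Finset.mem_filter, Finset.mem_univ, true_and]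
  constructor
  · rintro ⟨y, hy, rfl⟩
    exact ⟨pow_ne_zero 2 hy, y, sq y⟩
  · rintro ⟨hx, y, rfl⟩
    exact ⟨y, fun h => hx (by simp [h]), sq y⟩

/-- Twice the indicator of the residues is `χ + 1` away from `0`. -/
theorem two_mul_sum_quadraticResidues (f : F → ℂ) :
    2 * ∑ h ∈ quadraticResidues F, f h =
      ∑ x, complexQuadraticChar F x * f x + (∑ x, f x - f 0) := by
  rw [← Finset.sum_erase_eq_sub (Finset.mem_univ (0 : F)),
    ← Finset.sum_erase (s := Finset.univ) (f := fun x => complexQuadraticChar F x * f x)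
      (a := (0 : F)) (by simp [MulChar.map_zero]),
    ← Finset.sum_add_distrib, Finset.mul_sum]
  have hsub : quadraticResidues F ⊆ Finset.univ.erase 0 := fun x hx => by
    simpa using (mem_quadraticResidues.1 hx).1
  rw [← Finset.sum_subset hsub]
  · refine Finset.sum_congr rfl fun x hx => ?_
    obtain ⟨h0, hx⟩ := mem_quadraticResidues.1 hx
    rw [complexQuadraticChar_apply, (quadraticChar_one_iff_isSquare h0).2 hx]
    push_cast
    ring
  · intro x hx hx'
    have h0 : x ≠ 0 := by simpa using hx
    have : ¬ IsSquare x := fun h => hx' (mem_quadraticResidues.2 ⟨h0, h⟩)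
    rw [complexQuadraticChar_apply, quadraticChar_neg_one_iff_not_isSquare.2 this]
    push_cast
    ring

theorem complexQuadraticChar_sum (hF : ringChar F ≠ 2) :
    ∑ x, complexQuadraticChar F x = 0 := by
  simp only [complexQuadraticChar_apply]
  exact_mod_cast quadraticChar_sum_zero hF

theorem two_mul_card_quadraticResidues (hF : ringChar F ≠ 2) :
    2 * ((quadraticResidues F).card : ℂ) = (Fintype.card F : ℂ) - 1 := by
  have := two_mul_sum_quadraticResidues (F := F) (fun _ => 1)
  simpa [complexQuadraticChar_sum hF] using this

theorem complexQuadraticChar_mul_self {x : F} (hx : x ≠ 0) :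
    complexQuadraticChar F x * complexQuadraticChar F x = 1 := by
  rw [complexQuadraticChar_apply, ← Int.cast_mul, ← sq, quadraticChar_sq_one hx, Int.cast_one]

/-- The untwisted sum vanishes, so removing its term at `0` leaves `-1`; the twisted sum is a
shifted Gauss sum, and `χ(c)⁻¹ = χ(c)`. -/
theorem two_mul_sum_quadraticResidues_addChar {ψ : AddChar F ℂ} (hψ : ψ.IsPrimitive) {c : F}
    (hc : c ≠ 0) :
    2 * ∑ h ∈ quadraticResidues F, ψ (c * h) =
      complexQuadraticChar F c * gaussSum (complexQuadraticChar F) ψ - 1 := by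
  rw [two_mul_sum_quadraticResidues (fun h => ψ (c * h))]
  have h1 : ∑ x, ψ (c * x) = 0 := by
    simpa [mul_comm, hc] using AddChar.sum_mulShift c hψ
  have h2 := gaussSum_mulShift (complexQuadraticChar F) ψ (Units.mk0 c hc)
  rw [Units.val_mk0] at h2
  rw [h1, ← h2, ← mul_assoc, complexQuadraticChar_mul_self hc]
  simp [gaussSum, AddChar.mulShift_apply, sub_eq_add_neg]

theorem esymmSum_addChar_eq_twistedCycleSum {p : ℕ} [CharP F p] (hF : ringChar F ≠ 2)
    {ψ : AddChar F ℂ} (hψ : ψ.IsPrimitive) {x : F} (hx : x ≠ 0) (k : ℕ) {g : ℂ}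
    (hg : g = complexQuadraticChar F x * gaussSum (complexQuadraticChar F) ψ) :
    esymmSum (quadraticResidues F) (fun h => ψ (x * h)) k =
      (-1) ^ k * (twistedCycleSum p k (1 : Fˣ) ((1 - g) / 2) ((1 + g) / 2)
        ((1 - (Fintype.card F : ℂ)) / 2) / (k ! : ℂ)) := by
  have hk : (k ! : ℂ) ≠ 0 := by exact_mod_cast Nat.factorial_ne_zero k
  rw [twistedCycleSum, cycleSum_eq_factorial_mul, mul_div_cancel_left₀ _ hk]
  refine esymmSum_eq_partitionSum _ _ _ (fun i _ => ?_) k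
  have hpow : ∀ h : F, ψ (x * h) ^ i = ψ ((i : F) * x * h) := fun h => by
    rw [← AddChar.map_nsmul_eq_pow, nsmul_eq_mul, mul_assoc]
  simp only [hpow]
  split_ifs with h1 h2
  · have hi : (i : F) = 0 := (CharP.cast_eq_zero_iff F p i).2 h1
    have := two_mul_card_quadraticResidues hF
    simp only [hi, zero_mul, AddChar.map_zero_eq_one, Finset.sum_const, nsmul_eq_mul, mul_one]
    linear_combination this / 2
  -- For `p ∤ i`, `χ(i * x) = χ(i) χ(x)` and `g` already contains `χ(x)`, so `χ(i)` alone decides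
  -- the branch.
  all_goals
    have hi : (i : F) ≠ 0 := fun h => h1 ((CharP.cast_eq_zero_iff F p i).1 h)
    have hsum := two_mul_sum_quadraticResidues_addChar hψ (mul_ne_zero hi hx)
    rw [map_mul, mul_assoc, ← hg] at hsum
    rw [Units.val_one, map_one] at h2
  · rw [complexQuadraticChar_apply, h2, Int.cast_one, one_mul] at hsum
    linear_combination hsum / 2
  · rw [complexQuadraticChar_apply, (quadraticChar_dichotomy hi).resolve_left h2] at hsum
    push_cast at hsum
    linear_combination hsum / 2

theorem card_mul_subsetSumCount {ψ : AddChar F ℂ} (hψ : ψ.IsPrimitive) (H : Finset F) (k : ℕ) :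
    (Fintype.card F : ℂ) * subsetSumCount H k 0 = ∑ x, esymmSum H (fun h => ψ (x * h)) k := by
  have h : ∀ x, esymmSum H (fun h => ψ (x * h)) k =
      ∑ S ∈ H.powersetCard k, ψ (x * ∑ a ∈ S, a) := fun x => by
    refine Finset.sum_congr rfl fun S _ => ?_
    rw [Finset.mul_sum]
    exact (map_prod ψ.toMonoidHom (fun a => Multiplicative.ofAdd (x * a)) S).symm
  simp only [h]
  rw [Finset.sum_comm]
  simp only [AddChar.sum_mulShift _ hψ]
  rw [subsetSumCount, Finset.card_filter]
  push_cast
  rw [Finset.mul_sum]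
  exact Finset.sum_congr rfl fun S _ => by split_ifs <;> simp

/-- A function of a sign is affine in it, and the linear part dies because `χ` sums to `0`. -/
theorem sum_erase_zero_complexQuadraticChar_comp (hF : ringChar F ≠ 2) (T : ℂ → ℂ) (G : ℂ) :
    ∑ x ∈ Finset.univ.erase (0 : F), T (complexQuadraticChar F x * G) =
      ((Fintype.card F : ℂ) - 1) / 2 * (T G + T (-G)) := by
  have h : ∀ x ∈ Finset.univ.erase (0 : F), T (complexQuadraticChar F x * G) =
      (T G + T (-G)) / 2 + complexQuadraticChar F x * ((T G - T (-G)) / 2) := by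
    intro x hx
    have hx : x ≠ 0 := by simpa using hx
    rcases quadraticChar_dichotomy hx with h | h <;>
    · rw [complexQuadraticChar_apply, h]
      push_cast
      simp only [one_mul, neg_one_mul]
      ring
  rw [Finset.sum_congr rfl h, Finset.sum_add_distrib, ← Finset.sum_mul,
    Finset.sum_erase (f := fun x => complexQuadraticChar F x) _ (MulChar.map_zero _),
    complexQuadraticChar_sum hF,
    Finset.sum_const, Finset.card_erase_of_mem (Finset.mem_univ _), Finset.card_univ, nsmul_eq_mul,
    Nat.cast_sub Fintype.card_pos]
  push_cast
  ring

theorem exists_addChar_isPrimitive (F : Type*) [Field F] [Finite F] :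
    ∃ ψ : AddChar F ℂ, ψ.IsPrimitive := by
  obtain ⟨ψ, hψ⟩ := AddChar.exists_apply_ne_zero.2 (one_ne_zero (α := F))
  exact ⟨ψ, AddChar.IsPrimitive.of_ne_one fun h => hψ (by simp [h])⟩

theorem complexQuadraticChar_gaussSum_sq (hF : ringChar F ≠ 2) {ψ : AddChar F ℂ}
    (hψ : ψ.IsPrimitive) :
    gaussSum (complexQuadraticChar F) ψ ^ 2 =
      complexQuadraticChar F (-1) * (Fintype.card F : ℂ) :=
  gaussSum_sq ((MulChar.ringHomComp_ne_one_iff Int.cast_injective).2 (quadraticChar_ne_one hF))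
    ((quadraticChar_isQuadratic F).comp _) hψ

/-- The count of zero-sum subsets in terms of a square root `g` of `χ(-1) q`. -/
theorem subsetSumCount_quadraticResidues (p : ℕ) [CharP F p] (hF : ringChar F ≠ 2) (k : ℕ)
    {g : ℂ} (hg : g ^ 2 = complexQuadraticChar F (-1) * (Fintype.card F : ℂ)) :
    (subsetSumCount (quadraticResidues F) k 0 : ℂ) =
      1 / (Fintype.card F : ℂ) * (((Fintype.card F - 1) / 2).choose k : ℂ) +
        (-1) ^ k * (((Fintype.card F : ℂ) - 1) / (2 * (Fintype.card F : ℂ) * (k ! : ℂ))) *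
          (twistedCycleSum p k (1 : Fˣ) ((1 - g) / 2) ((1 + g) / 2)
              ((1 - (Fintype.card F : ℂ)) / 2) +
            twistedCycleSum p k (1 : Fˣ) ((1 + g) / 2) ((1 - g) / 2)
              ((1 - (Fintype.card F : ℂ)) / 2)) := by
  obtain ⟨ψ, hψ⟩ := exists_addChar_isPrimitive F
  have hq : (Fintype.card F : ℂ) ≠ 0 := by exact_mod_cast Fintype.card_ne_zero
  have hk : (k ! : ℂ) ≠ 0 := by exact_mod_cast Nat.factorial_ne_zero k
  have hcard : (quadraticResidues F).card = (Fintype.card F - 1) / 2 := by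
    have h : 2 * (quadraticResidues F).card + 1 = Fintype.card F := by
      have := two_mul_card_quadraticResidues hF
      rw [eq_sub_iff_add_eq] at this
      exact_mod_cast this
    omega
  have hzero : esymmSum (quadraticResidues F) (fun h => ψ (0 * h)) k =
      (((Fintype.card F - 1) / 2).choose k : ℂ) := by
    simp [esymmSum, hcard]
  let T : ℂ → ℂ := fun g => twistedCycleSum p k (1 : Fˣ) ((1 - g) / 2) ((1 + g) / 2)
    ((1 - (Fintype.card F : ℂ)) / 2)
  have hT : twistedCycleSum p k (1 : Fˣ) ((1 + g) / 2) ((1 - g) / 2)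
      ((1 - (Fintype.card F : ℂ)) / 2) = T (-g) := by
    simp only [T, sub_neg_eq_add, ← sub_eq_add_neg]
  -- `g` and the Gauss sum have the same square, so they agree up to sign.
  have hsymm : T g + T (-g) = T (gaussSum (complexQuadraticChar F) ψ) +
      T (-gaussSum (complexQuadraticChar F) ψ) := by
    rcases sq_eq_sq_iff_eq_or_eq_neg.1
      (hg.trans (complexQuadraticChar_gaussSum_sq hF hψ).symm) with h | h
    · rw [h]
    · rw [h, neg_neg, add_comm]
  have hmain := card_mul_subsetSumCount hψ (quadraticResidues F) k
  rw [← Finset.add_sum_erase _ _ (Finset.mem_univ (0 : F)), hzero,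
    Finset.sum_congr rfl fun x hx => esymmSum_addChar_eq_twistedCycleSum (p := p) hF hψ
      (Finset.ne_of_mem_erase hx) k rfl,
    ← Finset.mul_sum, ← Finset.sum_div,
    sum_erase_zero_complexQuadraticChar_comp hF T, ← hsymm] at hmain
  rw [hT]
  change _ = _ + _ * (T g + T (-g))
  apply mul_left_cancel₀ hq
  rw [hmain]
  field_simp

end FiniteField

theorem theorem5p2 {F : Type*} [Field F] [Fintype F] [DecidableEq F]
    (p s q : ℕ) (hp : p.Prime) (hp2 : p ≠ 2) (hq : q = p ^ s) (hF : Fintype.card F = q)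
    (k : ℕ) :
    ((p % 4 = 1 ∨ (p % 4 = 3 ∧ Even s)) →
      (subsetSumCount (quadraticResidues F) k 0 : ℂ) =
        1 / (q : ℂ) * (((q - 1) / 2).choose k : ℂ) +
          (-1) ^ k * (((q : ℂ) - 1) / (2 * (q : ℂ) * (k.factorial : ℂ))) *
            (twistedCycleSum p k (1 : Fˣ)
                ((1 - (Real.sqrt (q : ℝ) : ℂ)) / 2) ((1 + (Real.sqrt (q : ℝ) : ℂ)) / 2)
                ((1 - (q : ℂ)) / 2) +
              twistedCycleSum p k (1 : Fˣ)
                ((1 + (Real.sqrt (q : ℝ) : ℂ)) / 2) ((1 - (Real.sqrt (q : ℝ) : ℂ)) / 2)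
                ((1 - (q : ℂ)) / 2))) ∧
    ((p % 4 = 3 ∧ Odd s) →
      (subsetSumCount (quadraticResidues F) k 0 : ℂ) =
        1 / (q : ℂ) * (((q - 1) / 2).choose k : ℂ) +
          (-1) ^ k * (((q : ℂ) - 1) / (2 * (q : ℂ) * (k.factorial : ℂ))) *
            (twistedCycleSum p k (1 : Fˣ)
                ((1 - (Real.sqrt (q : ℝ) : ℂ) * Complex.I) / 2)
                ((1 + (Real.sqrt (q : ℝ) : ℂ) * Complex.I) / 2)
                ((1 - (q : ℂ)) / 2) +
              twistedCycleSum p k (1 : Fˣ)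
                ((1 + (Real.sqrt (q : ℝ) : ℂ) * Complex.I) / 2)
                ((1 - (Real.sqrt (q : ℝ) : ℂ) * Complex.I) / 2)
                ((1 - (q : ℂ)) / 2))) := by
  subst hF
  have : Fact p.Prime := ⟨hp⟩
  have hchar : CharP F p := charP_of_card_eq_prime_pow hq
  have hF : ringChar F ≠ 2 := by rwa [ringChar.eq F p]
  have hsqrt : (Real.sqrt ((Fintype.card F : ℕ) : ℝ) : ℂ) ^ 2 = (Fintype.card F : ℂ) := by
    exact_mod_cast congrArg (Complex.ofReal) (Real.sq_sqrt (Nat.cast_nonneg (Fintype.card F)))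
  constructor
  · intro h
    refine subsetSumCount_quadraticResidues p hF k ?_
    -- `-1` is a square exactly when `q % 4 ≠ 3`; for even `s`, use `3 ^ 2 % 4 = 1`.
    have hmod : Fintype.card F % 4 ≠ 3 := by
      rw [hq, Nat.pow_mod]
      rcases h with h | ⟨h, r, rfl⟩
      · simp [h]
      · rw [h, ← two_mul, pow_mul, Nat.pow_mod]
        simp
    rw [hsqrt, complexQuadraticChar_apply, (quadraticChar_one_iff_isSquare (by simp)).2
      (FiniteField.isSquare_neg_one_iff.2 hmod), Int.cast_one, one_mul]
  · rintro ⟨h, r, rfl⟩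
    refine subsetSumCount_quadraticResidues p hF k ?_
    have hmod : ¬ Fintype.card F % 4 ≠ 3 := by
      rw [hq, Nat.pow_mod, h, pow_succ, pow_mul, Nat.mul_mod, Nat.pow_mod]
      simp
    rw [mul_pow, hsqrt, Complex.I_sq, complexQuadraticChar_apply,
      quadraticChar_neg_one_iff_not_isSquare.2 (mt FiniteField.isSquare_neg_one_iff.1 hmod)]
    push_cast
    ring
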